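/- Let $\mathcal T$, $M$ be smooth manifolds of dimensions $m$, $n$ with local coordinates $(t^a)$, $(x^i)$ (indices $a,b,c,\dots$ run over $1..m$, $i,j,k,\dots$ over $1..n$, repeated indices are summed), and let $E^*=J^{1*}(\mathcal T,M)$ be the dual 1-jet space with induced coordinates $(t^a,x^i,p^a_i)$, where $\tilde p^a_i=\frac{\partial x^j}{\partial\tilde x^i}\frac{\partial\tilde t^a}{\partial t^b}p^b_j$. Let $h_{ab}(t)$ be a semi-Riemannian metric on $\mathcal T$ with Christoffel symbols $\chi^a_{bc}$ and curvature $$\chi^d_{abc}=\frac{\partial\chi^d_{ab}}{\partial t^c}-\frac{\partial\chi^d_{ac}}{\partial t^b}+\chi^f_{ab}\chi^d_{fc}-\chi^f_{ac}\chi^d_{fb}.$$ Let $N=(N_1{}^{(a)}_{(i)b},N_2{}^{(a)}_{(i)j})$ be a nonlinear connection on $E^*$, with adapted basis $$\frac{\delta}{\delta t^a}=\frac{\partial}{\partial t^a}-N_1{}^{(b)}_{(j)a}\frac{\partial}{\partial p^b_j},\qquad \frac{\delta}{\delta x^i}=\frac{\partial}{\partial x^i}-N_2{}^{(b)}_{(j)i}\frac{\partial}{\partial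 p^b_j},\qquad \frac{\partial}{\partial p^a_i},$$ dual basis $dt^a$, $dx^i$, $\delta p^a_i=dp^a_i+N_1{}^{(a)}_{(i)b}dt^b+N_2{}^{(a)}_{(i)j}dx^j$, and projections $h_{\mathcal T},h_M,v$ onto the three spans. Let $D$ be an $h$-normal $N$-linear connection of Cartan type on $E^*$, that is, a linear connection with $Dh_{\mathcal T}=0$, $Dh_M=0$, $Dv=0$, whose adapted components, defined by $$D_{\frac{\delta}{\delta t^c}}\tfrac{\delta}{\delta t^b}=A^a_{bc}\tfrac{\delta}{\delta t^a},\quad D_{\frac{\delta}{\delta x^i}}\tfrac{\delta}{\delta t^b}=H^a_{bi}\tfrac{\delta}{\delta t^a},\quad D_{\frac{\partial}{\partial p^c_i}}\tfrac{\delta}{\delta t^b}=C^{a(i)}_{b(c)}\tfrac{\delta}{\delta t^a},$$ $$D_{\frac{\delta}{\delta t^c}}\tfrac{\delta}{\delta x^j}=A^i_{jc}\tfrac{\delta}{\delta x^i},\quad D_{\frac{\delta}{\delta x^k}}\tfrac{\delta}{\delta x^j}=H^i_{jk}\tfrac{\delta}{\delta x^i},\quad D_{\frac{\partial}{\partial p^c_k}}\tfrac{\delta}{\delta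 x^j}=C^{i(k)}_{j(c)}\tfrac{\delta}{\delta x^i},$$ satisfy $A^a_{bc}=\chi^a_{bc}$, $H^a_{bi}=0$, $C^{a(i)}_{b(c)}=0$, $D\mathbb J=0$ for $\mathbb J=h_{ab}\delta^i_j\,\delta p^a_i\otimes dt^b\otimes dx^j$, and $H^i_{jk}=H^i_{kj}$, $C^{i(k)}_{j(c)}=C^{k(i)}_{j(c)}$. Denote by $_{/c}$, $_{|k}$, $|^{(k)}_{(c)}$ the local covariant derivatives of $D$ along $\frac{\delta}{\delta t^c}$, $\frac{\delta}{\delta x^k}$, $\frac{\partial}{\partial p^c_k}$ on d-tensors. For the adapted basis $(Y_A)$ put $\mathbb T(Y_C,Y_B)=\mathbb T^F_{BC}Y_F$ with $\mathbb T(X,Y)=D_XY-D_YX-[X,Y]$, and $\mathbb R(Y_C,Y_B)Y_A=\mathbb R^F_{ABC}Y_F$ with $\mathbb R(X,Y)Z=D_XD_YZ-D_YD_XZ-D_{[X,Y]}Z$. Write $T^r_{bk}$ for the $\frac{\delta}{\delta x^r}$-component $\mathbb T^F_{BC}$ with $B=b$, $C=k$; write $R^{(f)}_{(r)bc},R^{(f)}_{(r)bk},R^{(f)}_{(r)jk},P^{(f)\,(k)}_{(r)b(c)},P^{(f)\,(k)}_{(r)j(c)},S^{(f)(j)(k)}_{(r)(b)(c)}$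 for the $\frac{\partial}{\partial p^f_r}$-components $\mathbb T^F_{BC}$ and $R^r_{ibc},R^r_{ibk},R^r_{ijk},P^{r\,(k)}_{ib(c)},P^{r\,(k)}_{ij(c)},S^{r(j)(k)}_{i(b)(c)}$ for the $\frac{\delta}{\delta x^r}$-components $\mathbb R^F_{ABC}$ with $A=i$, where $(B,C)$ is, in this order, $(b,c)$, $(b,k)$, $(j,k)$, $(b,{}^{(k)}_{(c)})$, $(j,{}^{(k)}_{(c)})$, $({}^{(j)}_{(b)},{}^{(k)}_{(c)})$. For the Liouville–Hamilton field $\mathbb C^*=p^a_i\frac{\partial}{\partial p^a_i}$ let $\Delta^{(a)}_{(i)b}=p^a_{i/b}$, $\Delta^{(a)}_{(i)j}=p^a_{i|j}$, $\vartheta^{(a)(j)}_{(i)(b)}=p^a_i|^{(j)}_{(b)}$ be the deflection d-tensors. Then $$\Delta^{(a)}_{(i)b}=-N_1{}^{(a)}_{(i)b}-A^r_{ib}p^a_r+\chi^a_{fb}p^f_i,\qquad \Delta^{(a)}_{(i)j}=-N_2{}^{(a)}_{(i)j}-H^r_{ij}p^a_r,\qquad \vartheta^{(a)(j)}_{(i)(b)}=\delta^a_b\delta^j_i-C^{r(j)}_{i(b)}p^a_r,$$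 and the following six identities hold: $$\begin{aligned} \Delta^{(a)}_{(i)b/c}-\Delta^{(a)}_{(i)c/b}&=-p^a_rR^r_{ibc}+p^f_i\chi^a_{fbc}-\vartheta^{(a)(r)}_{(i)(f)}R^{(f)}_{(r)bc},\\ \Delta^{(a)}_{(i)b|k}-\Delta^{(a)}_{(i)k/b}&=-p^a_rR^r_{ibk}-\Delta^{(a)}_{(i)r}T^r_{bk}-\vartheta^{(a)(r)}_{(i)(f)}R^{(f)}_{(r)bk},\\ \Delta^{(a)}_{(i)j|k}-\Delta^{(a)}_{(i)k|j}&=-p^a_rR^r_{ijk}-\vartheta^{(a)(r)}_{(i)(f)}R^{(f)}_{(r)jk},\\ \Delta^{(a)}_{(i)b}|^{(k)}_{(c)}-\vartheta^{(a)(k)}_{(i)(c)/b}&=-p^a_rP^{r\,(k)}_{ib(c)}-\vartheta^{(a)(r)}_{(i)(f)}P^{(f)\,(k)}_{(r)b(c)},\\ \Delta^{(a)}_{(i)j}|^{(k)}_{(c)}-\vartheta^{(a)(k)}_{(i)(c)|j}&=-p^a_rP^{r\,(k)}_{ij(c)}-\Delta^{(a)}_{(i)r}C^{r(k)}_{j(c)}-\vartheta^{(a)(r)}_{(i)(f)}P^{(f)\,(k)}_{(r)j(c)},\\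 \vartheta^{(a)(j)}_{(i)(b)}|^{(k)}_{(c)}-\vartheta^{(a)(k)}_{(i)(c)}|^{(j)}_{(b)}&=-p^a_rS^{r(j)(k)}_{i(b)(c)}-\vartheta^{(a)(r)}_{(i)(f)}S^{(f)(j)(k)}_{(r)(b)(c)}. \end{aligned}$$ -/

import Mathlib

open scoped Manifold ContDiff

noncomputable section

/-! ### The dual 1-jet space `E* = J^{1*}(𝒯, M)` through its charts -/

/-- `ℝ^k`, the model space of `k`-dimensional manifolds. -/
abbrev Coord (k : ℕ) : Type := EuclideanSpace ℝ (Fin k)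

/-- The coordinate space `(t^a, x^i, p^a_i)` of `E*`; `z.2.2 a i` is `p^a_i`. -/
abbrev JCoord (m n : ℕ) : Type := Coord m × Coord n × (Fin m → Fin n → ℝ)

/-- The smooth charts of a `k`-dimensional manifold. -/
abbrev SmoothChart (k : ℕ) (X : Type*) [TopologicalSpace X] [ChartedSpace (Coord k) X] : Type _ :=
  {φ : OpenPartialHomeomorph X (Coord k) // φ ∈ IsManifold.maximalAtlas (𝓡 k) ∞ X}

/-- The coordinate change `φ' ∘ φ⁻¹`. -/
def chartChange {k : ℕ} {X : Type*} [TopologicalSpace X] [ChartedSpace (Coord k) X]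
    (φ φ' : SmoothChart k X) (u : Coord k) : Coord k :=
  φ'.1 (φ.1.symm u)

/-- The domain, in the coordinates `φ`, of the coordinate change `φ' ∘ φ⁻¹`. -/
def chartOverlap {k : ℕ} {X : Type*} [TopologicalSpace X] [ChartedSpace (Coord k) X]
    (φ φ' : SmoothChart k X) : Set (Coord k) :=
  {u | u ∈ φ.1.target ∧ φ.1.symm u ∈ φ'.1.source}

/-- The Jacobian entry `∂ũ^a/∂u^b` of the coordinate change from `φ` to `φ'`. -/
def chartJac {k : ℕ} {X : Type*} [TopologicalSpace X] [ChartedSpace (Coord k) X]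
    (φ φ' : SmoothChart k X) (u : Coord k) (a b : Fin k) : ℝ :=
  (fderiv ℝ (chartChange φ φ') u (EuclideanSpace.single b 1)) a

section JetCharts

variable {m n : ℕ} {T M : Type*} [TopologicalSpace T] [ChartedSpace (Coord m) T]
  [TopologicalSpace M] [ChartedSpace (Coord n) M]

/-- The image of the chart of `E*` induced by the charts `φ` of `𝒯` and `ψ` of `M`
(the fibre coordinates `p^a_i` are unrestricted). -/
def jetDomain (φ : SmoothChart m T) (ψ : SmoothChart n M) : Set (JCoord m n) :=
  {z | z.1 ∈ φ.1.target ∧ z.2.1 ∈ ψ.1.target}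

/-- The part of `jetDomain φ ψ` on which the chart `(φ', ψ')` is defined as well. -/
def jetOverlap (φ φ' : SmoothChart m T) (ψ ψ' : SmoothChart n M) : Set (JCoord m n) :=
  {z | z.1 ∈ chartOverlap φ φ' ∧ z.2.1 ∈ chartOverlap ψ ψ'}

/-- The coordinate transformation of `E*`:
`t̃ = t̃(t)`, `x̃ = x̃(x)`, `p̃^a_i = (∂x^j/∂x̃^i) (∂t̃^a/∂t^b) p^b_j`. -/
def jetChange (φ φ' : SmoothChart m T) (ψ ψ' : SmoothChart n M) (z : JCoord m n) : JCoord m n :=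
  (chartChange φ φ' z.1, chartChange ψ ψ' z.2.1, fun a i =>
    ∑ b, ∑ j, chartJac ψ' ψ (chartChange ψ ψ' z.2.1) j i * chartJac φ φ' z.1 a b * z.2.2 b j)

end JetCharts

/-! ### Semi-Riemannian metric on `𝒯`, nonlinear connections, linear connections -/

/-- A semi-Riemannian metric `h_{ab}(t)` on `𝒯`, by its components in all smooth charts. -/
structure SemiRiemannianMetric (m : ℕ) (T : Type*) [TopologicalSpace T]
    [ChartedSpace (Coord m) T] where
  comp : SmoothChart m T → Coord m → Matrix (Fin m) (Fin m) ℝ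
  smooth : ∀ φ a b, ContDiffOn ℝ ∞ (fun t => comp φ t a b) φ.1.target
  symm : ∀ φ, ∀ t ∈ φ.1.target, (comp φ t).IsSymm
  nondegenerate : ∀ φ, ∀ t ∈ φ.1.target, (comp φ t).det ≠ 0
  transform : ∀ φ φ', ∀ t ∈ chartOverlap φ φ', ∀ a b,
    comp φ t a b = ∑ c, ∑ d,
      comp φ' (chartChange φ φ' t) c d * chartJac φ φ' t c a * chartJac φ φ' t d b

namespace SemiRiemannianMetric

variable {m : ℕ} {T : Type*} [TopologicalSpace T] [ChartedSpace (Coord m) T]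

/-- `∂h_{ab}/∂t^c`. -/
def dComp (h : SemiRiemannianMetric m T) (φ : SmoothChart m T) (t : Coord m)
    (a b c : Fin m) : ℝ :=
  fderiv ℝ (fun s => h.comp φ s a b) t (EuclideanSpace.single c 1)

/-- The Christoffel symbols `χ^a_{bc}` of `h`. -/
def christoffel (h : SemiRiemannianMetric m T) (φ : SmoothChart m T) (t : Coord m)
    (a b c : Fin m) : ℝ :=
  (1 / 2) * ∑ d, (h.comp φ t)⁻¹ a d *
    (h.dComp φ t d c b + h.dComp φ t d b c - h.dComp φ t b c d)

/-- The curvature `χ^d_{abc} = ∂χ^d_{ab}/∂t^c - ∂χ^d_{ac}/∂t^b + χ^f_{ab} χ^d_{fc} -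
χ^f_{ac} χ^d_{fb}` of `h`. -/
def chiCurv (h : SemiRiemannianMetric m T) (φ : SmoothChart m T) (t : Coord m)
    (d a b c : Fin m) : ℝ :=
  fderiv ℝ (fun s => h.christoffel φ s d a b) t (EuclideanSpace.single c 1)
    - fderiv ℝ (fun s => h.christoffel φ s d a c) t (EuclideanSpace.single b 1)
    + ∑ f, (h.christoffel φ t f a b * h.christoffel φ t d f c
      - h.christoffel φ t f a c * h.christoffel φ t d f b)

end SemiRiemannianMetric

/-- A nonlinear connection on `E*`: local functions `N₁^{(a)}_{(i)b}` (`N1 φ ψ a i b`) and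
`N₂^{(a)}_{(i)j}` (`N2 φ ψ a i j`) in every induced chart, with their transformation rules. -/
structure NonlinearConnection (m n : ℕ) (T M : Type*) [TopologicalSpace T]
    [ChartedSpace (Coord m) T] [TopologicalSpace M] [ChartedSpace (Coord n) M] where
  N1 : SmoothChart m T → SmoothChart n M → Fin m → Fin n → Fin m → JCoord m n → ℝ
  N2 : SmoothChart m T → SmoothChart n M → Fin m → Fin n → Fin n → JCoord m n → ℝ
  smooth1 : ∀ φ ψ a i b, ContDiffOn ℝ ∞ (N1 φ ψ a i b) (jetDomain φ ψ)
  smooth2 : ∀ φ ψ a i j, ContDiffOn ℝ ∞ (N2 φ ψ a i j) (jetDomain φ ψ)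
  transform1 : ∀ φ φ' ψ ψ', ∀ z ∈ jetOverlap φ φ' ψ ψ', ∀ b j a,
    ∑ c, N1 φ' ψ' b j c (jetChange φ φ' ψ ψ' z) * chartJac φ φ' z.1 c a
      = ∑ c, ∑ k, N1 φ ψ c k a z * chartJac φ φ' z.1 b c
            * chartJac ψ' ψ (chartChange ψ ψ' z.2.1) k j
        - (fderiv ℝ (jetChange φ φ' ψ ψ') z (EuclideanSpace.single a 1, 0, 0)).2.2 b j
  transform2 : ∀ φ φ' ψ ψ', ∀ z ∈ jetOverlap φ φ' ψ ψ', ∀ b j i,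
    ∑ k, N2 φ' ψ' b j k (jetChange φ φ' ψ ψ' z) * chartJac ψ ψ' z.2.1 k i
      = ∑ c, ∑ k, N2 φ ψ c k i z * chartJac φ φ' z.1 b c
            * chartJac ψ' ψ (chartChange ψ ψ' z.2.1) k j
        - (fderiv ℝ (jetChange φ φ' ψ ψ') z (0, EuclideanSpace.single i 1, 0)).2.2 b j

/-- A smooth linear connection `D` on (the tangent bundle of) `E*`, given in every induced chart
as a covariant derivative on the chart's image, compatible with the coordinate transformations of
vector fields. `cov φ ψ Y z (X z)` is the value `(D_X Y)(z)` in the chart `(φ, ψ)`. -/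
structure LinearConnection (m n : ℕ) (T M : Type*) [TopologicalSpace T]
    [ChartedSpace (Coord m) T] [TopologicalSpace M] [ChartedSpace (Coord n) M] where
  cov : SmoothChart m T → SmoothChart n M →
    (JCoord m n → JCoord m n) → JCoord m n → JCoord m n →L[ℝ] JCoord m n
  isCovariantDerivative : ∀ φ ψ,
    IsCovariantDerivativeOn (I := 𝓘(ℝ, JCoord m n)) (V := TangentSpace 𝓘(ℝ, JCoord m n))
      (JCoord m n) (cov φ ψ) (jetDomain φ ψ)
  smooth : ∀ φ ψ (Y : JCoord m n → JCoord m n), ContDiffOn ℝ ∞ Y (jetDomain φ ψ) →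
    ContDiffOn ℝ ∞ (cov φ ψ Y) (jetDomain φ ψ)
  transform : ∀ φ φ' ψ ψ', ∀ z ∈ jetOverlap φ φ' ψ ψ', ∀ Y : JCoord m n → JCoord m n,
    DifferentiableAt ℝ Y (jetChange φ φ' ψ ψ' z) → ∀ v : JCoord m n,
      fderiv ℝ (jetChange φ φ' ψ ψ') z
          (cov φ ψ (VectorField.pullback ℝ (jetChange φ φ' ψ ψ') Y) z v)
        = cov φ' ψ' Y (jetChange φ φ' ψ ψ' z) (fderiv ℝ (jetChange φ φ' ψ ψ') z v)

/-! ### Adapted components in one chart -/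

/-- The indices `a`, `i` and `(a, i)` of the adapted bases. -/
abbrev DIdx (m n : ℕ) : Type := Fin m ⊕ Fin n ⊕ (Fin m × Fin n)

/-- The adapted index of `δ/δt^a`, `dt^a`. -/
abbrev tI {m n : ℕ} (a : Fin m) : DIdx m n := Sum.inl a

/-- The adapted index of `δ/δx^i`, `dx^i`. -/
abbrev xI {m n : ℕ} (i : Fin n) : DIdx m n := Sum.inr (Sum.inl i)

/-- The adapted index of `∂/∂p^a_i`, `δp^a_i`. -/
abbrev pI {m n : ℕ} (a : Fin m) (i : Fin n) : DIdx m n := Sum.inr (Sum.inr (a, i))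

/-- The expressions of a nonlinear connection and of a linear connection in one chart of `E*`. -/
structure LocalGeometry (m n : ℕ) where
  N1 : Fin m → Fin n → Fin m → JCoord m n → ℝ
  N2 : Fin m → Fin n → Fin n → JCoord m n → ℝ
  cov : (JCoord m n → JCoord m n) → JCoord m n → JCoord m n →L[ℝ] JCoord m n

namespace LocalGeometry

variable {m n : ℕ} (G : LocalGeometry m n)

/-- The adapted frame `δ/δt^a = ∂/∂t^a - N₁^{(b)}_{(j)a} ∂/∂p^b_j`,
`δ/δx^i = ∂/∂x^i - N₂^{(b)}_{(j)i} ∂/∂p^b_j`, `∂/∂p^a_i`. -/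
def frame : DIdx m n → JCoord m n → JCoord m n
  | .inl a, z => (EuclideanSpace.single a 1, 0, fun b j => -G.N1 b j a z)
  | .inr (.inl i), z => (0, EuclideanSpace.single i 1, fun b j => -G.N2 b j i z)
  | .inr (.inr (a, i)), _ => (0, 0, Pi.single a (Pi.single i 1))

/-- The adapted coframe `dt^a`, `dx^i`,
`δp^a_i = dp^a_i + N₁^{(a)}_{(i)b} dt^b + N₂^{(a)}_{(i)j} dx^j` at `z`, applied to `v`. -/
def coframe : DIdx m n → JCoord m n → JCoord m n → ℝ
  | .inl a, _, v => v.1 a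
  | .inr (.inl i), _, v => v.2.1 i
  | .inr (.inr (a, i)), z, v =>
      v.2.2 a i + ∑ b, G.N1 a i b z * v.1 b + ∑ j, G.N2 a i j z * v.2.1 j

/-- The projection `h_𝒯` at `z`. -/
def projHT (z v : JCoord m n) : JCoord m n :=
  ∑ a : Fin m, G.coframe (tI a) z v • G.frame (tI a) z

/-- The projection `h_M` at `z`. -/
def projHM (z v : JCoord m n) : JCoord m n :=
  ∑ i : Fin n, G.coframe (xI i) z v • G.frame (xI i) z

/-- The projection `v` at `z`. -/
def projV (z v : JCoord m n) : JCoord m n :=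
  ∑ a : Fin m, ∑ i : Fin n, G.coframe (pI a i) z v • G.frame (pI a i) z

/-- `D h_𝒯 = 0`, `D h_M = 0`, `D v = 0` on `W`, where `(D_X h) Y = D_X (h Y) - h (D_X Y)`. -/
def IsNLinearOn (W : Set (JCoord m n)) : Prop :=
  ∀ z ∈ W, ∀ Y : JCoord m n → JCoord m n, DifferentiableAt ℝ Y z → ∀ v : JCoord m n,
    G.cov (fun w => G.projHT w (Y w)) z v = G.projHT z (G.cov Y z v) ∧
    G.cov (fun w => G.projHM w (Y w)) z v = G.projHM z (G.cov Y z v) ∧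
    G.cov (fun w => G.projV w (Y w)) z v = G.projV z (G.cov Y z v)

/-- The adapted components of `D`: `D_{Y_C} Y_B = Γ^F_{BC} Y_F`. In particular
`A^a_{bc} = Γ (tI a) (tI b) (tI c)`, `A^i_{jc} = Γ (xI i) (xI j) (tI c)`,
`H^i_{jk} = Γ (xI i) (xI j) (xI k)`, `C^{i(k)}_{j(c)} = Γ (xI i) (xI j) (pI c k)`. -/
def Γ (F B C : DIdx m n) (z : JCoord m n) : ℝ :=
  G.coframe F z (G.cov (G.frame B) z (G.frame C z))

/-- The torsion `𝕋(X, Y) = D_X Y - D_Y X - [X, Y]`. -/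
def torsion (X Y : JCoord m n → JCoord m n) (z : JCoord m n) : JCoord m n :=
  G.cov Y z (X z) - G.cov X z (Y z) - VectorField.lieBracket ℝ X Y z

/-- The curvature `R(X, Y) Z = D_X D_Y Z - D_Y D_X Z - D_{[X, Y]} Z`. -/
def curvature (X Y Z : JCoord m n → JCoord m n) (z : JCoord m n) : JCoord m n :=
  G.cov (fun w => G.cov Z w (Y w)) z (X z) - G.cov (fun w => G.cov Z w (X w)) z (Y z)
    - G.cov Z z (VectorField.lieBracket ℝ X Y z)

/-- The torsion d-tensors: `𝕋(Y_C, Y_B) = 𝕋^F_{BC} Y_F`. -/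
def tors (F B C : DIdx m n) (z : JCoord m n) : ℝ :=
  G.coframe F z (G.torsion (G.frame C) (G.frame B) z)

/-- The curvature d-tensors: `R(Y_C, Y_B) Y_A = R^F_{ABC} Y_F`. -/
def curv (F A B C : DIdx m n) (z : JCoord m n) : ℝ :=
  G.coframe F z (G.curvature (G.frame C) (G.frame B) (G.frame A) z)

/-- The derivative of a function along the `C`-th vector of the adapted frame. -/
def along (C : DIdx m n) (f : JCoord m n → ℝ) (z : JCoord m n) : ℝ :=
  fderiv ℝ f z (G.frame C z)

/-- The local covariant derivatives `X^A_{:C}` of a d-vector field with adapted components `X^A`;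
the derivative is `/c`, `|k` or `|^{(k)}_{(c)}` for `C = tI c`, `xI k` or `pI c k`. -/
def covVec (X : DIdx m n → JCoord m n → ℝ) (A C : DIdx m n) (z : JCoord m n) : ℝ :=
  G.along C (X A) z + ∑ F, X F z * G.Γ A F C z

/-- The local covariant derivatives `S^A_{B:C}` of a d-tensor field `S^A_B Y_A ⊗ ω^B`. -/
def covTensor (S : DIdx m n → DIdx m n → JCoord m n → ℝ) (A B C : DIdx m n)
    (z : JCoord m n) : ℝ :=
  G.along C (S A B) z + ∑ F, S F B z * G.Γ A F C z - ∑ F, S A F z * G.Γ F B C z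

/-- The local covariant derivatives `J_{ABE:C}` of a d-tensor field `J_{ABE} ω^A ⊗ ω^B ⊗ ω^E`. -/
def covForm (J : DIdx m n → DIdx m n → DIdx m n → JCoord m n → ℝ) (A B E C : DIdx m n)
    (z : JCoord m n) : ℝ :=
  G.along C (J A B E) z - ∑ F, G.Γ F A C z * J F B E z - ∑ F, G.Γ F B C z * J A F E z
    - ∑ F, G.Γ F E C z * J A B F z

/-- The canonical Liouville-Hamilton d-tensor field `ℂ* = p^a_i ∂/∂p^a_i`. -/
def liouville (z : JCoord m n) : JCoord m n := (0, 0, z.2.2)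

/-- The deflection d-tensors, i.e. the components `ℂ*^A_{:B}` of `D ℂ*`:
`Δ^{(a)}_{(i)b} = p^a_{i/b}` is `defl (pI a i) (tI b)`,
`Δ^{(a)}_{(i)j} = p^a_{i|j}` is `defl (pI a i) (xI j)`,
`ϑ^{(a)(j)}_{(i)(b)} = p^a_i|^{(j)}_{(b)}` is `defl (pI a i) (pI b j)`. -/
def defl (A B : DIdx m n) (z : JCoord m n) : ℝ :=
  G.covVec (fun F w => G.coframe F w (liouville w)) A B z

/-- The local covariant derivatives of the deflection d-tensors; for instance
`Δ^{(a)}_{(i)b|k}` is `covDefl (pI a i) (tI b) (xI k)`. -/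
def covDefl (A B C : DIdx m n) (z : JCoord m n) : ℝ :=
  G.covTensor G.defl A B C z

end LocalGeometry

/-! ### `h`-normal `N`-linear connections of Cartan type -/

section Cartan

variable {m n : ℕ} {T M : Type*} [TopologicalSpace T] [ChartedSpace (Coord m) T]
  [TopologicalSpace M] [ChartedSpace (Coord n) M]

/-- The components of the `h`-normalization d-tensor field
`𝕁 = h_{ab} δ^i_j δp^a_i ⊗ dt^b ⊗ dx^j`. -/
def normalizationTensor (h : SemiRiemannianMetric m T) (φ : SmoothChart m T) :
    DIdx m n → DIdx m n → DIdx m n → JCoord m n → ℝ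
  | .inr (.inr (a, i)), .inl b, .inr (.inl j), z => if i = j then h.comp φ z.1 a b else 0
  | _, _, _, _ => 0

/-- The expressions of `N` and `D` in the chart of `E*` induced by `φ` and `ψ`. -/
def localGeometry (N : NonlinearConnection m n T M) (D : LinearConnection m n T M)
    (φ : SmoothChart m T) (ψ : SmoothChart n M) : LocalGeometry m n :=
  ⟨N.N1 φ ψ, N.N2 φ ψ, D.cov φ ψ⟩

/-- `D` is an `N`-linear connection. -/
def IsNLinear (N : NonlinearConnection m n T M) (D : LinearConnection m n T M) : Prop :=
  ∀ φ ψ, (localGeometry N D φ ψ).IsNLinearOn (jetDomain φ ψ)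

/-- `D` is an `h`-normal `N`-linear connection: it is `N`-linear and `A^a_{bc} = χ^a_{bc}`,
`H^a_{bi} = 0`, `C^{a(i)}_{b(c)} = 0`, `D𝕁 = 0`. -/
structure IsHNormal (h : SemiRiemannianMetric m T) (N : NonlinearConnection m n T M)
    (D : LinearConnection m n T M) : Prop where
  nLinear : IsNLinear N D
  temporal : ∀ φ ψ, ∀ z ∈ jetDomain φ ψ, ∀ a b c,
    (localGeometry N D φ ψ).Γ (tI a) (tI b) (tI c) z = h.christoffel φ z.1 a b c
  spatial : ∀ φ ψ, ∀ z ∈ jetDomain φ ψ, ∀ a b i,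
    (localGeometry N D φ ψ).Γ (tI a) (tI b) (xI i) z = 0
  vertical : ∀ φ ψ, ∀ z ∈ jetDomain φ ψ, ∀ a b c i,
    (localGeometry N D φ ψ).Γ (tI a) (tI b) (pI c i) z = 0
  normalization : ∀ φ ψ, ∀ z ∈ jetDomain φ ψ, ∀ A B E C,
    (localGeometry N D φ ψ).covForm (normalizationTensor h φ) A B E C z = 0

/-- `D` is an `h`-normal `N`-linear connection of Cartan type: moreover `H^i_{jk} = H^i_{kj}` and
`C^{i(k)}_{j(c)} = C^{k(i)}_{j(c)}`. -/
structure IsCartanType (h : SemiRiemannianMetric m T) (N : NonlinearConnection m n T M)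
    (D : LinearConnection m n T M) : Prop extends IsHNormal h N D where
  symmH : ∀ φ ψ, ∀ z ∈ jetDomain φ ψ, ∀ i j k,
    (localGeometry N D φ ψ).Γ (xI i) (xI j) (xI k) z
      = (localGeometry N D φ ψ).Γ (xI i) (xI k) (xI j) z
  symmC : ∀ φ ψ, ∀ z ∈ jetDomain φ ψ, ∀ i j c k,
    (localGeometry N D φ ψ).Γ (xI i) (xI j) (pI c k) z
      = (localGeometry N D φ ψ).Γ (xI k) (xI j) (pI c i) z

end Cartan

end

/-! All six identities are one Ricci identity, read in the six pairs of directions of the adapted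
frame. For a d-vector field $X$, the commutator of second covariant derivatives is $X^F\mathbb
R^A_{FBC}-X^A_{:F}\mathbb T^F_{BC}$ (`ricci_identity`). Applied to the Liouville-Hamilton field, the
first derivatives are the deflections, and only the vertical components $p^a_i$ enter the curvature
term.

What remains is to evaluate curvature and torsion. Since $h$ is parallel and nondegenerate,
$D\mathbb J=0$ determines the vertical coefficients: $D$ acts on vertical vectors as on the tensor
product of the temporal bundle with the dual of the spatial one (`IsHNormal.isVerticallyInducedOn`).
Hence the vertical curvature is the temporal curvature minus the transposed spatial curvature
(`curv_pI`), which gives the terms $p^f_i\chi^a_{fbc}$ and $-p^a_rR^r_{ibc}$. The temporal curvature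
is that of $h$ on two temporal directions (`curv_tI_tI_tI`) and vanishes as soon as one direction is
not temporal (`curv_tI_inr`).

Brackets of the adapted frame are vertical, so the horizontal torsion is the antisymmetrization of
the connection coefficients. $N$-linearity and the symmetries of $\chi$ and $H$ remove all of it
except $T^r_{bk}$ and $C^{r(k)}_{j(c)}$. -/

namespace LocalGeometry

variable {m n : ℕ} {G : LocalGeometry m n}

/-! ### The adapted frame and coframe -/

variable (G) in
lemma coframe_isLinearMap (F : DIdx m n) (z : JCoord m n) :
    IsLinearMap ℝ (G.coframe F z) := by
  rcases F with a | i | ⟨a, i⟩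
  · constructor <;> intros <;> simp [coframe]
  · constructor <;> intros <;> simp [coframe]
  · constructor <;> intros <;>
      simp [coframe, mul_add, Finset.sum_add_distrib, Finset.mul_sum, mul_left_comm]
    ring

variable (G) in
lemma coframe_add (F : DIdx m n) (z u v : JCoord m n) :
    G.coframe F z (u + v) = G.coframe F z u + G.coframe F z v :=
  (G.coframe_isLinearMap F z).map_add u v

variable (G) in
lemma coframe_sub (F : DIdx m n) (z u v : JCoord m n) :
    G.coframe F z (u - v) = G.coframe F z u - G.coframe F z v :=
  (G.coframe_isLinearMap F z).map_sub u v

variable (G) in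
lemma coframe_smul (F : DIdx m n) (z : JCoord m n) (c : ℝ) (v : JCoord m n) :
    G.coframe F z (c • v) = c * G.coframe F z v :=
  (G.coframe_isLinearMap F z).map_smul c v

variable (G) in
lemma coframe_sum {ι : Type*} (s : Finset ι) (F : DIdx m n) (z : JCoord m n)
    (v : ι → JCoord m n) : G.coframe F z (∑ i ∈ s, v i) = ∑ i ∈ s, G.coframe F z (v i) :=
  map_sum ((G.coframe_isLinearMap F z).mk' _) v s

lemma coframe_frame (F B : DIdx m n) (z : JCoord m n) :
    G.coframe F z (G.frame B z) = if F = B then 1 else 0 := by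
  rcases F with a | i | ⟨a, i⟩ <;> rcases B with b | j | ⟨b, j⟩ <;>
    simp [coframe, frame, Pi.single_apply]
  · split_ifs <;> simp_all

lemma sum_coframe_smul_frame (z v : JCoord m n) :
    ∑ F, G.coframe F z v • G.frame F z = v := by
  simp only [Fintype.sum_sum_type, Fintype.sum_prod_type]
  refine Prod.ext ?_ (Prod.ext ?_ ?_)
  · ext a
    simp [coframe, frame, Prod.fst_sum, Finset.sum_apply, Pi.single_apply]
  · ext a
    simp [coframe, frame, Prod.fst_sum, Prod.snd_sum, Pi.single_apply]
  · ext a i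
    have key (c : Fin m → Fin n → ℝ) :
        ∑ b, ∑ j, c b j * (Pi.single b (Pi.single j 1) : Fin m → Fin n → ℝ) a i = c a i := by
      simp [Pi.single_apply, ite_apply]
    simp [coframe, frame, Prod.snd_sum, Finset.sum_apply, key]
    simp [mul_comm]

end LocalGeometry

/-! ### Pointwise rules for covariant derivatives on a subset of a normed space -/

section
variable {E : Type*} [NormedAddCommGroup E] [NormedSpace ℝ E]

/-- The tangent bundle of a vector space is trivial, so the bundle axioms of a covariant derivative
can be used for ordinary maps `E → E`. -/
lemma mdifferentiableAt_vectorSpace_of_differentiableAt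
    {Y : Π x : E, TangentSpace 𝓘(ℝ, E) x} {z : E}
    (hY : DifferentiableAt ℝ (F := E) Y z) :
    MDifferentiableAt 𝓘(ℝ, E) (𝓘(ℝ, E).prod 𝓘(ℝ, E))
      (fun w => (⟨w, Y w⟩ : Bundle.TotalSpace E (TangentSpace 𝓘(ℝ, E)))) z := by
  rw [mdifferentiableAt_section]
  convert! hY.mdifferentiableAt with w
  simp

namespace IsCovariantDerivativeOn
variable {cov : (E → E) → E → E →L[ℝ] E} {W : Set E} {z : E}

lemma apply_zero
    (hcov : IsCovariantDerivativeOn (I := 𝓘(ℝ, E)) (V := TangentSpace 𝓘(ℝ, E)) E cov W)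
    (hz : z ∈ W) (v : E) : cov (fun _ => 0) z v = 0 :=
  congrArg (fun L : E →L[ℝ] E => L v) (hcov.zero hz)

lemma apply_add
    (hcov : IsCovariantDerivativeOn (I := 𝓘(ℝ, E)) (V := TangentSpace 𝓘(ℝ, E)) E cov W)
    (hz : z ∈ W) {X Y : E → E} (hX : DifferentiableAt ℝ X z) (hY : DifferentiableAt ℝ Y z)
    (v : E) : cov (fun w => X w + Y w) z v = cov X z v + cov Y z v :=
  congrArg (fun L : E →L[ℝ] E => L v)
    (hcov.add (σ := X) (σ' := Y) (mdifferentiableAt_vectorSpace_of_differentiableAt hX)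
      (mdifferentiableAt_vectorSpace_of_differentiableAt hY) hz)

lemma apply_smul
    (hcov : IsCovariantDerivativeOn (I := 𝓘(ℝ, E)) (V := TangentSpace 𝓘(ℝ, E)) E cov W)
    (hz : z ∈ W) {f : E → ℝ} {X : E → E} (hf : DifferentiableAt ℝ f z)
    (hX : DifferentiableAt ℝ X z) (v : E) :
    cov (fun w => f w • X w) z v = fderiv ℝ f z v • X z + f z • cov X z v := by
  rw [add_comm, ← mfderiv_eq_fderiv]
  exact congrArg (fun L : E →L[ℝ] E => L v)
    (hcov.leibniz (σ := X) (mdifferentiableAt_vectorSpace_of_differentiableAt hX)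
      hf.mdifferentiableAt hz)

lemma apply_sum_smul {ι : Type*}
    (hcov : IsCovariantDerivativeOn (I := 𝓘(ℝ, E)) (V := TangentSpace 𝓘(ℝ, E)) E cov W)
    (hz : z ∈ W) (s : Finset ι) {f : ι → E → ℝ} {X : ι → E → E}
    (hf : ∀ i, DifferentiableAt ℝ (f i) z) (hX : ∀ i, DifferentiableAt ℝ (X i) z) (v : E) :
    cov (fun w => ∑ i ∈ s, f i w • X i w) z v
      = ∑ i ∈ s, (fderiv ℝ (f i) z v • X i z + f i z • cov (X i) z v) := by
  classical
  induction s using Finset.induction_on with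
  | empty => simpa using hcov.apply_zero hz v
  | insert i s hi ih =>
    simp only [Finset.sum_insert hi]
    rw [← ih, ← hcov.apply_smul hz (hf i) (hX i)]
    exact hcov.apply_add hz ((hf i).smul (hX i)) (.fun_sum fun j _ => (hf j).smul (hX j)) v

end IsCovariantDerivativeOn
end

namespace LocalGeometry

variable {m n : ℕ} {G : LocalGeometry m n} {W : Set (JCoord m n)} {z : JCoord m n}

/-! ### Smooth local geometries -/

variable (G) in
/-- The nonlinear connection of `G` is smooth on the open set `W`, and the linear connection of `G`
is a smooth covariant derivative on `W`. -/
structure IsSmoothOn (W : Set (JCoord m n)) : Prop where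
  isOpen : IsOpen W
  smooth1 : ∀ a i b, ContDiffOn ℝ ∞ (G.N1 a i b) W
  smooth2 : ∀ a i j, ContDiffOn ℝ ∞ (G.N2 a i j) W
  isCovariantDerivative : IsCovariantDerivativeOn (I := 𝓘(ℝ, JCoord m n))
    (V := TangentSpace 𝓘(ℝ, JCoord m n)) (JCoord m n) G.cov W
  smooth : ∀ Y : JCoord m n → JCoord m n, ContDiffOn ℝ ∞ Y W → ContDiffOn ℝ ∞ (G.cov Y) W

namespace IsSmoothOn

lemma differentiableAt (hG : G.IsSmoothOn W) (hz : z ∈ W) {E : Type*} [NormedAddCommGroup E]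
    [NormedSpace ℝ E] {f : JCoord m n → E} (hf : ContDiffOn ℝ ∞ f W) : DifferentiableAt ℝ f z :=
  (hf.contDiffAt (hG.isOpen.mem_nhds hz)).differentiableAt (by simp)

lemma contDiffOn_frame (hG : G.IsSmoothOn W) (B : DIdx m n) : ContDiffOn ℝ ∞ (G.frame B) W := by
  rcases B with b | j | ⟨b, j⟩
  · exact contDiffOn_const.prodMk (contDiffOn_const.prodMk
      (contDiffOn_pi.2 fun a => contDiffOn_pi.2 fun i => (hG.smooth1 a i b).neg))
  · exact contDiffOn_const.prodMk (contDiffOn_const.prodMk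
      (contDiffOn_pi.2 fun a => contDiffOn_pi.2 fun i => (hG.smooth2 a i j).neg))
  · exact contDiffOn_const

lemma contDiffOn_coframe (hG : G.IsSmoothOn W) (F : DIdx m n) {Y : JCoord m n → JCoord m n}
    (hY : ContDiffOn ℝ ∞ Y W) : ContDiffOn ℝ ∞ (fun w => G.coframe F w (Y w)) W := by
  have h1 (a : Fin m) : ContDiffOn ℝ ∞ (fun w => (Y w).1 a) W :=
    (EuclideanSpace.proj (𝕜 := ℝ) a).contDiff.comp_contDiffOn hY.fst
  have h2 (i : Fin n) : ContDiffOn ℝ ∞ (fun w => (Y w).2.1 i) W :=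
    (EuclideanSpace.proj (𝕜 := ℝ) i).contDiff.comp_contDiffOn hY.snd.fst
  rcases F with a | i | ⟨a, i⟩
  · exact h1 a
  · exact h2 i
  · have h3 : ContDiffOn ℝ ∞ (fun w => (Y w).2.2 a i) W :=
      contDiffOn_pi.1 (contDiffOn_pi.1 hY.snd.snd a) i
    exact (h3.add (.sum fun b _ => (hG.smooth1 a i b).mul (h1 b))).add
      (.sum fun j _ => (hG.smooth2 a i j).mul (h2 j))

lemma contDiffOn_Γ (hG : G.IsSmoothOn W) (F B C : DIdx m n) : ContDiffOn ℝ ∞ (G.Γ F B C) W :=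
  hG.contDiffOn_coframe F
    ((hG.smooth _ (hG.contDiffOn_frame B)).clm_apply (hG.contDiffOn_frame C))

lemma differentiableAt_Γ (hG : G.IsSmoothOn W) (hz : z ∈ W) (F B C : DIdx m n) :
    DifferentiableAt ℝ (G.Γ F B C) z :=
  hG.differentiableAt hz (hG.contDiffOn_Γ F B C)

lemma contDiffOn_along (hG : G.IsSmoothOn W) (C : DIdx m n) {f : JCoord m n → ℝ}
    (hf : ContDiffOn ℝ ∞ f W) : ContDiffOn ℝ ∞ (G.along C f) W :=
  (hf.fderiv_of_isOpen hG.isOpen (by simp)).clm_apply (hG.contDiffOn_frame C)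

end IsSmoothOn

/-! ### Structure coefficients of the adapted frame, torsion and curvature -/

variable (G) in
/-- The structure coefficients of the adapted frame: `[Y_C, Y_B] = L^F_{CB} Y_F`. -/
noncomputable def structureCoeff (F C B : DIdx m n) (z : JCoord m n) : ℝ :=
  G.coframe F z (VectorField.lieBracket ℝ (G.frame C) (G.frame B) z)

lemma cov_frame_apply (B : DIdx m n) (z v : JCoord m n) (F : DIdx m n) :
    G.coframe F z (G.cov (G.frame B) z v) = ∑ E, G.coframe E z v * G.Γ F B E z := by
  conv_lhs => rw [← G.sum_coframe_smul_frame z v]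
  simp only [map_sum, map_smul, coframe_sum, coframe_smul, Γ]

lemma tors_eq (F B C : DIdx m n) (z : JCoord m n) :
    G.tors F B C z = G.Γ F B C z - G.Γ F C B z - G.structureCoeff F C B z := by
  simp only [tors, torsion, coframe_sub, Γ, structureCoeff]

namespace IsSmoothOn

/-- Expand $D_{Y_B}Y_A$ in the frame with coefficients `Γ` and apply the Leibniz rule. -/
lemma coframe_cov_cov_frame (hG : G.IsSmoothOn W) (hz : z ∈ W) (F A B C : DIdx m n) :
    G.coframe F z (G.cov (fun w => G.cov (G.frame A) w (G.frame B w)) z (G.frame C z))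
      = G.along C (G.Γ F A B) z + ∑ E, G.Γ E A B z * G.Γ F E C z := by
  have h : (fun w => G.cov (G.frame A) w (G.frame B w))
      = fun w => ∑ E, G.Γ E A B w • G.frame E w :=
    funext fun w => (G.sum_coframe_smul_frame w _).symm
  rw [h, hG.isCovariantDerivative.apply_sum_smul hz _ (fun E => hG.differentiableAt_Γ hz E A B)
    (fun E => hG.differentiableAt hz (hG.contDiffOn_frame E))]
  simp only [coframe_sum, coframe_add, coframe_smul, coframe_frame, Finset.sum_add_distrib]
  simp [along, Γ]

lemma curv_eq (hG : G.IsSmoothOn W) (hz : z ∈ W) (F A B C : DIdx m n) :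
    G.curv F A B C z = G.along C (G.Γ F A B) z - G.along B (G.Γ F A C) z
      + ∑ E, G.Γ E A B z * G.Γ F E C z - ∑ E, G.Γ E A C z * G.Γ F E B z
      - ∑ E, G.structureCoeff E C B z * G.Γ F A E z := by
  simp only [curv, curvature, coframe_sub, hG.coframe_cov_cov_frame hz, cov_frame_apply,
    structureCoeff]
  ring

/-- The second derivative of `f` is symmetric, so only the derivatives of the frame vectors survive,
and these form the Lie bracket. -/
lemma along_along_sub (hG : G.IsSmoothOn W) (hz : z ∈ W) {f : JCoord m n → ℝ}
    (hf : ContDiffOn ℝ ∞ f W) (B C : DIdx m n) :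
    G.along C (G.along B f) z - G.along B (G.along C f) z
      = ∑ E, G.structureCoeff E C B z * G.along E f z := by
  have hf' : DifferentiableAt ℝ (fderiv ℝ f) z :=
    hG.differentiableAt hz (hf.fderiv_of_isOpen hG.isOpen (by simp))
  have key (B C : DIdx m n) : G.along C (G.along B f) z
      = fderiv ℝ (fderiv ℝ f) z (G.frame C z) (G.frame B z)
        + fderiv ℝ f z (fderiv ℝ (G.frame B) z (G.frame C z)) := by
    have h := hf'.hasFDerivAt.clm_apply
      (hG.differentiableAt hz (hG.contDiffOn_frame B)).hasFDerivAt
    change fderiv ℝ (fun w => fderiv ℝ f w (G.frame B w)) z (G.frame C z) = _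
    rw [h.fderiv]
    simp [add_comm]
  have hsymm : IsSymmSndFDerivAt ℝ f z :=
    (hf.contDiffAt (hG.isOpen.mem_nhds hz)).isSymmSndFDerivAt
      (by rw [minSmoothness_of_isRCLikeNormedField]; exact ENat.LEInfty.out)
  have hbr : ∑ E, G.structureCoeff E C B z * G.along E f z
      = fderiv ℝ f z (VectorField.lieBracket ℝ (G.frame C) (G.frame B) z) := by
    conv_rhs => rw [← G.sum_coframe_smul_frame z (VectorField.lieBracket ℝ _ _ z)]
    simp [structureCoeff, along]
  rw [hbr, key, key, hsymm.eq (G.frame C z), VectorField.lieBracket, map_sub]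
  ring

/-- The Ricci identity for the second covariant derivatives of a d-vector field. -/
theorem ricci_identity (hG : G.IsSmoothOn W) (hz : z ∈ W) {X : DIdx m n → JCoord m n → ℝ}
    (hX : ∀ A, ContDiffOn ℝ ∞ (X A) W) (A B C : DIdx m n) :
    G.covTensor (G.covVec X) A B C z - G.covTensor (G.covVec X) A C B z
      = ∑ F, X F z * G.curv A F B C z - ∑ F, G.covVec X A F z * G.tors F B C z := by
  have key (B C : DIdx m n) : G.along C (G.covVec X A B) z = G.along C (G.along B (X A)) z
      + ∑ F, (X F z * G.along C (G.Γ A F B) z + G.along C (X F) z * G.Γ A F B z) := by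
    have h := (hG.differentiableAt hz (hG.contDiffOn_along B (hX A))).hasFDerivAt.add
      (HasFDerivAt.fun_sum (u := Finset.univ) fun F _ =>
        (hG.differentiableAt hz (hX F)).hasFDerivAt.mul
          (hG.differentiableAt_Γ hz A F B).hasFDerivAt)
    change fderiv ℝ (G.along B (X A) + fun w => ∑ F, (X F * G.Γ A F B) w) z (G.frame C z) = _
    rw [HasFDerivAt.fderiv h]
    simp [along, mul_comm]
  have hcomm := hG.along_along_sub hz (hX A) B C
  -- Relabelling the double sum brings it to the form of the quadratic term of `curv_eq`.
  have hswap (B C : DIdx m n) : ∑ F, ∑ E, X E z * G.Γ F E B z * G.Γ A F C z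
      = ∑ F, X F z * ∑ E, G.Γ E F B z * G.Γ A E C z := by
    rw [Finset.sum_comm]
    simp only [Finset.mul_sum, mul_assoc]
  -- The bracket term of the torsion splits into the commutator of derivatives of $X^A$ and the
  -- $D_{[X,Y]}$ term of the curvature, so all structure coefficients cancel.
  have hstr : ∑ F, G.covVec X A F z * G.structureCoeff F C B z
      = ∑ E, G.structureCoeff E C B z * G.along E (X A) z
        + ∑ F, X F z * ∑ E, G.structureCoeff E C B z * G.Γ A F E z := by
    simp only [covVec, add_mul, Finset.sum_add_distrib, Finset.sum_mul, Finset.mul_sum]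
    rw [Finset.sum_comm (γ := DIdx m n)]
    simp only [mul_comm, mul_left_comm]
  have hcov (B C : DIdx m n) : ∑ F, G.covVec X F B z * G.Γ A F C z
      = ∑ F, G.along B (X F) z * G.Γ A F C z + ∑ F, X F z * ∑ E, G.Γ E F B z * G.Γ A E C z := by
    rw [← hswap]
    simp only [covVec, add_mul, Finset.sum_add_distrib, Finset.sum_mul]
  simp only [covTensor, key, hcov, hG.curv_eq hz, tors_eq, mul_sub, mul_add,
    Finset.sum_sub_distrib, Finset.sum_add_distrib, hstr]
  linarith

end IsSmoothOn
end LocalGeometry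

namespace LocalGeometry

variable {m n : ℕ} {G : LocalGeometry m n} {W : Set (JCoord m n)} {z : JCoord m n}

/-! ### Adapted components of an `N`-linear connection -/

section NLinear

/-- A frame vector fixed by a parallel projection has its covariant derivatives in the image of that
projection. The same argument gives the other vanishing coefficients below. -/
lemma Γ_inr_tI (hG : G.IsSmoothOn W) (hN : G.IsNLinearOn W) (hz : z ∈ W)
    (F : Fin n ⊕ Fin m × Fin n) (b : Fin m) (C : DIdx m n) :
    G.Γ (Sum.inr F) (tI b) C z = 0 := by
  have h := (hN z hz _ (hG.differentiableAt hz (hG.contDiffOn_frame (tI b))) (G.frame C z)).1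
  have hproj : (fun w => G.projHT w (G.frame (tI b) w)) = G.frame (tI b) := by
    funext w
    simp [projHT, coframe_frame]
  rw [hproj] at h
  rw [Γ, h]
  simp [projHT, coframe_sum, coframe_smul, coframe_frame]

lemma projHM_frame_xI (j : Fin n) :
    (fun w => G.projHM w (G.frame (xI j) w)) = G.frame (xI j) := by
  funext w
  simp [projHM, coframe_frame]

lemma Γ_tI_xI (hG : G.IsSmoothOn W) (hN : G.IsNLinearOn W) (hz : z ∈ W)
    (a : Fin m) (j : Fin n) (C : DIdx m n) : G.Γ (tI a) (xI j) C z = 0 := by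
  have h := (hN z hz _ (hG.differentiableAt hz (hG.contDiffOn_frame (xI j))) (G.frame C z)).2.1
  rw [projHM_frame_xI] at h
  rw [Γ, h]
  simp [projHM, coframe_sum, coframe_smul, coframe_frame]

lemma Γ_pI_xI (hG : G.IsSmoothOn W) (hN : G.IsNLinearOn W) (hz : z ∈ W)
    (a : Fin m) (i j : Fin n) (C : DIdx m n) : G.Γ (pI a i) (xI j) C z = 0 := by
  have h := (hN z hz _ (hG.differentiableAt hz (hG.contDiffOn_frame (xI j))) (G.frame C z)).2.1
  rw [projHM_frame_xI] at h
  rw [Γ, h]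
  simp [projHM, coframe_sum, coframe_smul, coframe_frame]

lemma projV_frame_pI (b : Fin m) (j : Fin n) :
    (fun w => G.projV w (G.frame (pI b j) w)) = G.frame (pI b j) := by
  funext w
  simp [projV, coframe_frame, ite_and]

lemma Γ_tI_pI (hG : G.IsSmoothOn W) (hN : G.IsNLinearOn W) (hz : z ∈ W)
    (a b : Fin m) (j : Fin n) (C : DIdx m n) : G.Γ (tI a) (pI b j) C z = 0 := by
  have h := (hN z hz _ (hG.differentiableAt hz (hG.contDiffOn_frame (pI b j))) (G.frame C z)).2.2
  rw [projV_frame_pI] at h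
  rw [Γ, h]
  simp [projV, coframe_sum, coframe_smul, coframe_frame]

lemma Γ_xI_pI (hG : G.IsSmoothOn W) (hN : G.IsNLinearOn W) (hz : z ∈ W)
    (i : Fin n) (b : Fin m) (j : Fin n) (C : DIdx m n) : G.Γ (xI i) (pI b j) C z = 0 := by
  have h := (hN z hz _ (hG.differentiableAt hz (hG.contDiffOn_frame (pI b j))) (G.frame C z)).2.2
  rw [projV_frame_pI] at h
  rw [Γ, h]
  simp [projV, coframe_sum, coframe_smul, coframe_frame]

end NLinear

/-! ### The structure coefficients have no horizontal part -/

/-- Only the fibre part of a frame vector varies with the point; this is what makes the brackets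
vertical. -/
lemma fderiv_frame_fst (hG : G.IsSmoothOn W) (hz : z ∈ W) (B : DIdx m n) (v : JCoord m n) :
    (fderiv ℝ (G.frame B) z v).1 = 0 := by
  have h := (hG.differentiableAt hz (hG.contDiffOn_frame B)).hasFDerivAt.fst
  have hc : (fun w => (G.frame B w).1) = fun _ => (G.frame B z).1 := by
    rcases B with b | j | ⟨b, j⟩ <;> rfl
  rw [hc] at h
  exact congrArg (fun L => L v) (h.unique (hasFDerivAt_const _ _))

lemma fderiv_frame_snd_fst (hG : G.IsSmoothOn W) (hz : z ∈ W) (B : DIdx m n) (v : JCoord m n) :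
    (fderiv ℝ (G.frame B) z v).2.1 = 0 := by
  have h := (hG.differentiableAt hz (hG.contDiffOn_frame B)).hasFDerivAt.snd.fst
  have hc : (fun w => (G.frame B w).2.1) = fun _ => (G.frame B z).2.1 := by
    rcases B with b | j | ⟨b, j⟩ <;> rfl
  rw [hc] at h
  exact congrArg (fun L => L v) (h.unique (hasFDerivAt_const _ _))

lemma structureCoeff_tI (hG : G.IsSmoothOn W) (hz : z ∈ W) (a : Fin m) (C B : DIdx m n) :
    G.structureCoeff (tI a) C B z = 0 := by
  simp [structureCoeff, VectorField.lieBracket, coframe, fderiv_frame_fst hG hz]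

lemma structureCoeff_xI (hG : G.IsSmoothOn W) (hz : z ∈ W) (i : Fin n) (C B : DIdx m n) :
    G.structureCoeff (xI i) C B z = 0 := by
  simp [structureCoeff, VectorField.lieBracket, coframe, fderiv_frame_snd_fst hG hz]

lemma tors_tI (hG : G.IsSmoothOn W) (hz : z ∈ W) (a : Fin m) (B C : DIdx m n) :
    G.tors (tI a) B C z = G.Γ (tI a) B C z - G.Γ (tI a) C B z := by
  rw [tors_eq, structureCoeff_tI hG hz, sub_zero]

lemma tors_xI (hG : G.IsSmoothOn W) (hz : z ∈ W) (i : Fin n) (B C : DIdx m n) :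
    G.tors (xI i) B C z = G.Γ (xI i) B C z - G.Γ (xI i) C B z := by
  rw [tors_eq, structureCoeff_xI hG hz, sub_zero]

/-! ### Deflection and curvature of a normalized `N`-linear connection -/

variable (G) in
/-- The vertical components of an `h`-normal connection, determined by the horizontal ones. -/
def IsVerticallyInducedOn (W : Set (JCoord m n)) : Prop :=
  ∀ z ∈ W, ∀ a i b j C, G.Γ (pI a i) (pI b j) C z
    = (if i = j then G.Γ (tI a) (tI b) C z else 0) - (if a = b then G.Γ (xI j) (xI i) C z else 0)

lemma along_fiberCoord (a : Fin m) (i : Fin n) (C : DIdx m n) (z : JCoord m n) :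
    G.along C (fun w => w.2.2 a i) z = (G.frame C z).2.2 a i := by
  let L : JCoord m n →L[ℝ] ℝ :=
    ((ContinuousLinearMap.proj i).comp (ContinuousLinearMap.proj (R := ℝ)
      (φ := fun _ : Fin m => Fin n → ℝ) a)).comp
      ((ContinuousLinearMap.snd ℝ _ _).comp (ContinuousLinearMap.snd ℝ _ _))
  change fderiv ℝ L z (G.frame C z) = _
  rw [L.fderiv]
  rfl

lemma defl_pI (hV : G.IsVerticallyInducedOn W)
    (hz : z ∈ W) (a : Fin m) (i : Fin n) (C : DIdx m n) :
    G.defl (pI a i) C z = (G.frame C z).2.2 a i + ∑ f, z.2.2 f i * G.Γ (tI a) (tI f) C z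
      - ∑ r, z.2.2 a r * G.Γ (xI r) (xI i) C z := by
  have h : (fun w => G.coframe (pI a i) w (liouville w)) = fun w => w.2.2 a i := by
    funext w; simp [coframe, liouville]
  rw [defl, covVec, h, along_fiberCoord]
  simp only [Fintype.sum_sum_type, Fintype.sum_prod_type, hV z hz, coframe, liouville]
  simp [mul_sub, Finset.sum_sub_distrib]
  ring

/-- This is the curvature of a tensor product with a dual: the mixed quadratic terms are symmetric
in the two directions and cancel, and dualizing transposes and changes sign. -/
lemma curv_pI (hG : G.IsSmoothOn W) (hN : G.IsNLinearOn W) (hV : G.IsVerticallyInducedOn W)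
    (hz : z ∈ W) (a : Fin m) (i : Fin n) (b : Fin m) (j : Fin n) (B C : DIdx m n) :
    G.curv (pI a i) (pI b j) B C z = (if i = j then G.curv (tI a) (tI b) B C z else 0)
      - (if a = b then G.curv (xI j) (xI i) B C z else 0) := by
  have hΓ (B C : DIdx m n) : G.along C (G.Γ (pI a i) (pI b j) B) z
      = (if i = j then G.along C (G.Γ (tI a) (tI b) B) z else 0)
        - (if a = b then G.along C (G.Γ (xI j) (xI i) B) z else 0) := by
    -- Differentiating the formula for `Γ` needs it near `z`, not only at `z`.
    have hev : G.Γ (pI a i) (pI b j) B =ᶠ[nhds z] fun w =>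
        (if i = j then G.Γ (tI a) (tI b) B w else 0)
          - (if a = b then G.Γ (xI j) (xI i) B w else 0) :=
      Filter.eventuallyEq_of_mem (hG.isOpen.mem_nhds hz) fun w hw => hV w hw a i b j B
    have h1 := hG.differentiableAt_Γ hz (tI a) (tI b) B
    have h2 := hG.differentiableAt_Γ hz (xI j) (xI i) B
    rw [along, hev.fderiv_eq]
    split_ifs
    · rw [fderiv_fun_sub h1 h2]; rfl
    · simp [along]
    · simp [along]
    · simp
  -- Dualizing reverses the order of the spatial products; both orders are brought to one form.
  have hcomm (B C : DIdx m n) : ∑ r, G.Γ (xI j) (xI r) B z * G.Γ (xI r) (xI i) C z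
      = ∑ r, G.Γ (xI r) (xI i) C z * G.Γ (xI j) (xI r) B z := by
    simp only [mul_comm]
  simp only [hG.curv_eq hz, Fintype.sum_sum_type, Fintype.sum_prod_type, Γ_tI_pI hG hN hz,
    Γ_xI_pI hG hN hz, Γ_tI_xI hG hN hz, Γ_pI_xI hG hN hz, Γ_inr_tI hG hN hz, hV z hz,
    structureCoeff_tI hG hz, structureCoeff_xI hG hz, zero_mul, mul_zero, Finset.sum_const_zero,
    zero_add, add_zero]
  simp [mul_sub, sub_mul, Finset.sum_sub_distrib, hΓ, hcomm]
  split_ifs <;> ring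

/-- The deflection identities before the torsion and the temporal curvature are evaluated. -/
theorem covDefl_sub_covDefl (hG : G.IsSmoothOn W) (hN : G.IsNLinearOn W)
    (hV : G.IsVerticallyInducedOn W) (hz : z ∈ W) (a : Fin m) (i : Fin n) (B C : DIdx m n) :
    G.covDefl (pI a i) B C z - G.covDefl (pI a i) C B z
      = -(∑ r, z.2.2 a r * G.curv (xI r) (xI i) B C z)
        + ∑ f, z.2.2 f i * G.curv (tI a) (tI f) B C z
        - ∑ f, G.defl (pI a i) (tI f) z * (G.Γ (tI f) B C z - G.Γ (tI f) C B z)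
        - ∑ r, G.defl (pI a i) (xI r) z * (G.Γ (xI r) B C z - G.Γ (xI r) C B z)
        - ∑ f, ∑ r, G.defl (pI a i) (pI f r) z * G.tors (pI f r) B C z := by
  have hL : ContDiffOn ℝ ∞ (liouville : JCoord m n → JCoord m n) W :=
    contDiffOn_const.prodMk (contDiffOn_const.prodMk contDiff_snd.snd.contDiffOn)
  have h := hG.ricci_identity hz (fun A => hG.contDiffOn_coframe A hL) (pI a i) B C
  refine h.trans ?_
  have hdefl (F : DIdx m n) : G.covVec (fun F w => G.coframe F w (liouville w)) (pI a i) F z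
      = G.defl (pI a i) F z := rfl
  simp only [hdefl, Fintype.sum_sum_type, Fintype.sum_prod_type, tors_tI hG hz, tors_xI hG hz,
    curv_pI hG hN hV hz]
  simp [coframe, liouville, mul_sub, Finset.sum_sub_distrib]
  ring

end LocalGeometry

/-! ### The Levi-Civita connection of $h$ in a chart -/

namespace SemiRiemannianMetric

variable {m : ℕ} {T : Type*} [TopologicalSpace T] [ChartedSpace (Coord m) T]
  (h : SemiRiemannianMetric m T) (φ : SmoothChart m T) {t : Coord m}

lemma differentiableAt_comp (ht : t ∈ φ.1.target) (a b : Fin m) :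
    DifferentiableAt ℝ (fun s => h.comp φ s a b) t :=
  ((h.smooth φ a b).contDiffAt (φ.1.open_target.mem_nhds ht)).differentiableAt (by simp)

lemma dComp_comm (ht : t ∈ φ.1.target) (a b c : Fin m) :
    h.dComp φ t a b c = h.dComp φ t b a c := by
  have hev : (fun s => h.comp φ s a b) =ᶠ[nhds t] fun s => h.comp φ s b a :=
    Filter.eventuallyEq_of_mem (φ.1.open_target.mem_nhds ht) fun s hs => (h.symm φ s hs).apply b a
  rw [dComp, dComp, hev.fderiv_eq]

lemma christoffel_comm (ht : t ∈ φ.1.target) (a b c : Fin m) :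
    h.christoffel φ t a b c = h.christoffel φ t a c b := by
  simp only [christoffel, h.dComp_comm φ ht b c]
  congr 1
  refine Finset.sum_congr rfl fun d _ => ?_
  ring

/-- Lowering the upper index cancels the inverse metric and leaves the Christoffel symbols of the
first kind. -/
lemma sum_comp_mul_christoffel (ht : t ∈ φ.1.target) (a b c : Fin m) :
    ∑ f, h.comp φ t a f * h.christoffel φ t f b c
      = (1 / 2) * (h.dComp φ t a c b + h.dComp φ t a b c - h.dComp φ t b c a) := by
  let S : Fin m → ℝ := fun d => h.dComp φ t d c b + h.dComp φ t d b c - h.dComp φ t b c d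
  have hinv : h.comp φ t * (h.comp φ t)⁻¹ = 1 :=
    Matrix.mul_nonsing_inv _ (isUnit_iff_ne_zero.2 (h.nondegenerate φ t ht))
  have hS : Matrix.mulVec (h.comp φ t) (Matrix.mulVec (h.comp φ t)⁻¹ S) a = S a := by
    rw [Matrix.mulVec_mulVec, hinv, Matrix.one_mulVec]
  change ∑ f, h.comp φ t a f * ((1 / 2) * Matrix.mulVec (h.comp φ t)⁻¹ S f) = (1 / 2) * S a
  rw [← hS, Matrix.mulVec, dotProduct, Finset.mul_sum]
  exact Finset.sum_congr rfl fun f _ => by ring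

/-- The Levi-Civita connection is metric. -/
lemma dComp_eq_sum_christoffel (ht : t ∈ φ.1.target) (a b c : Fin m) :
    h.dComp φ t a b c = ∑ f, h.comp φ t a f * h.christoffel φ t f b c
      + ∑ f, h.comp φ t f b * h.christoffel φ t f a c := by
  have hsymm : ∑ f, h.comp φ t f b * h.christoffel φ t f a c
      = ∑ f, h.comp φ t b f * h.christoffel φ t f a c :=
    Finset.sum_congr rfl fun f _ => by rw [(h.symm φ t ht).apply]
  rw [hsymm, h.sum_comp_mul_christoffel φ ht, h.sum_comp_mul_christoffel φ ht,
    h.dComp_comm φ ht b a, h.dComp_comm φ ht b c, h.dComp_comm φ ht a c]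
  ring

end SemiRiemannianMetric

namespace LocalGeometry

lemma along_comp_fst {m n : ℕ} (G : LocalGeometry m n) {z : JCoord m n} {f : Coord m → ℝ}
    (hf : DifferentiableAt ℝ f z.1) (C : DIdx m n) :
    G.along C (fun w => f w.1) z = fderiv ℝ f z.1 (G.frame C z).1 := by
  have h := hf.hasFDerivAt.comp z hasFDerivAt_fst
  change fderiv ℝ (f ∘ Prod.fst) z _ = _
  rw [h.fderiv]
  rfl

end LocalGeometry

/-! ### Consequences of $h$-normality in an induced chart -/

section Charts

variable {m n : ℕ} {T M : Type*} [TopologicalSpace T] [ChartedSpace (Coord m) T]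
  [TopologicalSpace M] [ChartedSpace (Coord n) M] {h : SemiRiemannianMetric m T}
  {N : NonlinearConnection m n T M} {D : LinearConnection m n T M}
  {φ : SmoothChart m T} {ψ : SmoothChart n M} {z : JCoord m n}

lemma isOpen_jetDomain (φ : SmoothChart m T) (ψ : SmoothChart n M) : IsOpen (jetDomain φ ψ) :=
  (φ.1.open_target.preimage continuous_fst).inter
    (ψ.1.open_target.preimage (continuous_fst.comp continuous_snd))

lemma localGeometry_isSmoothOn (N : NonlinearConnection m n T M) (D : LinearConnection m n T M)
    (φ : SmoothChart m T) (ψ : SmoothChart n M) :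
    (localGeometry N D φ ψ).IsSmoothOn (jetDomain φ ψ) where
  isOpen := isOpen_jetDomain φ ψ
  smooth1 := N.smooth1 φ ψ
  smooth2 := N.smooth2 φ ψ
  isCovariantDerivative := D.isCovariantDerivative φ ψ
  smooth := D.smooth φ ψ

namespace IsHNormal

/-- The metric is parallel for $D$ in every adapted direction: by the Levi-Civita property along
$\delta/\delta t^c$, and because both sides vanish in the others, $h$ depending on $t$ alone. -/
lemma along_comp (hD : IsHNormal h N D) (hz : z ∈ jetDomain φ ψ) (a b : Fin m) (C : DIdx m n) :
    (localGeometry N D φ ψ).along C (fun w => h.comp φ w.1 a b) z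
      = ∑ f, h.comp φ z.1 a f * (localGeometry N D φ ψ).Γ (tI f) (tI b) C z
        + ∑ f, h.comp φ z.1 f b * (localGeometry N D φ ψ).Γ (tI f) (tI a) C z := by
  rw [LocalGeometry.along_comp_fst _ (h.differentiableAt_comp φ hz.1 a b)]
  rcases C with c | k | ⟨c, k⟩
  · simp only [hD.temporal φ ψ z hz]
    exact h.dComp_eq_sum_christoffel φ hz.1 a b c
  · simp [hD.spatial φ ψ z hz, LocalGeometry.frame]
  · simp [hD.vertical φ ψ z hz, LocalGeometry.frame]

lemma isVerticallyInducedOn (hD : IsHNormal h N D) (φ : SmoothChart m T) (ψ : SmoothChart n M) :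
    (localGeometry N D φ ψ).IsVerticallyInducedOn (jetDomain φ ψ) := by
  intro z hz f j a i C
  set G := localGeometry N D φ ψ with hGdef
  -- The defect of the formula is treated as a row vector in `f`; $D\mathbb J=0$ says that its
  -- product with the invertible matrix $h$ is zero.
  suffices hvec : (fun f => G.Γ (pI f j) (pI a i) C z
      - ((if j = i then G.Γ (tI f) (tI a) C z else 0)
        - (if f = a then G.Γ (xI i) (xI j) C z else 0))) = 0 from
    sub_eq_zero.1 (congrFun hvec f)
  refine Matrix.eq_zero_of_vecMul_eq_zero (h.nondegenerate φ z.1 hz.1) ?_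
  funext b
  have hJ := hD.normalization φ ψ z hz (pI a i) (tI b) (xI j) C
  have hmet := hD.along_comp hz a b C
  rw [← hGdef] at hJ hmet
  simp only [LocalGeometry.covForm, Fintype.sum_sum_type, Fintype.sum_prod_type,
    normalizationTensor] at hJ
  simp [Matrix.vecMul, dotProduct, sub_mul, Finset.sum_sub_distrib] at hJ ⊢
  have hnorm : G.along C (normalizationTensor h φ (pI a i) (tI b) (xI j)) z
      = if i = j then G.along C (fun w => h.comp φ w.1 a b) z else 0 := by
    change G.along C (fun w => if i = j then h.comp φ w.1 a b else 0) z = _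
    split_ifs <;> simp [LocalGeometry.along]
  rw [hnorm, hmet] at hJ
  simp only [eq_comm (a := j), mul_comm (h.comp φ z.1 _ _)] at hJ ⊢
  split_ifs at hJ ⊢ <;> linarith

lemma along_christoffel (hD : IsHNormal h N D) (hz : z ∈ jetDomain φ ψ) (d a b : Fin m)
    (C : DIdx m n) :
    (localGeometry N D φ ψ).along C ((localGeometry N D φ ψ).Γ (tI d) (tI a) (tI b)) z
      = fderiv ℝ (fun s => h.christoffel φ s d a b) z.1
          ((localGeometry N D φ ψ).frame C z).1 := by
  have hev : (localGeometry N D φ ψ).Γ (tI d) (tI a) (tI b)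
      =ᶠ[nhds z] fun w => h.christoffel φ w.1 d a b :=
    Filter.eventuallyEq_of_mem ((isOpen_jetDomain φ ψ).mem_nhds hz)
      fun w hw => hD.temporal φ ψ w hw d a b
  -- Differentiability of $\chi$ is inherited from the smooth coefficients of $D$, then restricted
  -- to the slice with $(x,p)$ fixed.
  have hdiff : DifferentiableAt ℝ (fun w : JCoord m n => h.christoffel φ w.1 d a b) z :=
    hev.differentiableAt_iff.1
      ((localGeometry_isSmoothOn N D φ ψ).differentiableAt_Γ hz (tI d) (tI a) (tI b))
  have hχ : DifferentiableAt ℝ (fun s => h.christoffel φ s d a b) z.1 :=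
    DifferentiableAt.comp (g := fun w : JCoord m n => h.christoffel φ w.1 d a b)
      (f := fun s => (s, z.2)) z.1 hdiff (differentiableAt_id.prodMk (differentiableAt_const _))
  rw [← LocalGeometry.along_comp_fst _ hχ, LocalGeometry.along, LocalGeometry.along,
    hev.fderiv_eq]

lemma along_Γ_tI_xI (hD : IsHNormal h N D) (hz : z ∈ jetDomain φ ψ) (d a : Fin m) (k : Fin n)
    (C : DIdx m n) :
    (localGeometry N D φ ψ).along C ((localGeometry N D φ ψ).Γ (tI d) (tI a) (xI k)) z = 0 := by
  have hev : (localGeometry N D φ ψ).Γ (tI d) (tI a) (xI k) =ᶠ[nhds z] fun _ => 0 :=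
    Filter.eventuallyEq_of_mem ((isOpen_jetDomain φ ψ).mem_nhds hz)
      fun w hw => hD.spatial φ ψ w hw d a k
  rw [LocalGeometry.along, hev.fderiv_eq]
  simp

lemma along_Γ_tI_pI (hD : IsHNormal h N D) (hz : z ∈ jetDomain φ ψ) (d a c : Fin m) (k : Fin n)
    (C : DIdx m n) :
    (localGeometry N D φ ψ).along C ((localGeometry N D φ ψ).Γ (tI d) (tI a) (pI c k)) z = 0 := by
  have hev : (localGeometry N D φ ψ).Γ (tI d) (tI a) (pI c k) =ᶠ[nhds z] fun _ => 0 :=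
    Filter.eventuallyEq_of_mem ((isOpen_jetDomain φ ψ).mem_nhds hz)
      fun w hw => hD.vertical φ ψ w hw d a c k
  rw [LocalGeometry.along, hev.fderiv_eq]
  simp

lemma curv_tI (hD : IsHNormal h N D) (hz : z ∈ jetDomain φ ψ) (d a : Fin m) (B C : DIdx m n) :
    (localGeometry N D φ ψ).curv (tI d) (tI a) B C z
      = (localGeometry N D φ ψ).along C ((localGeometry N D φ ψ).Γ (tI d) (tI a) B) z
        - (localGeometry N D φ ψ).along B ((localGeometry N D φ ψ).Γ (tI d) (tI a) C) z
        + ∑ e, ((localGeometry N D φ ψ).Γ (tI e) (tI a) B z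
            * (localGeometry N D φ ψ).Γ (tI d) (tI e) C z
          - (localGeometry N D φ ψ).Γ (tI e) (tI a) C z
            * (localGeometry N D φ ψ).Γ (tI d) (tI e) B z) := by
  have hG := localGeometry_isSmoothOn N D φ ψ
  simp only [hG.curv_eq hz, Fintype.sum_sum_type,
    LocalGeometry.Γ_inr_tI hG (hD.nLinear φ ψ) hz, LocalGeometry.structureCoeff_tI hG hz,
    LocalGeometry.structureCoeff_xI hG hz, hD.vertical φ ψ z hz, zero_mul, mul_zero,
    Finset.sum_const_zero, add_zero, sub_zero, Finset.sum_sub_distrib]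
  ring

lemma curv_tI_tI_tI (hD : IsHNormal h N D) (hz : z ∈ jetDomain φ ψ) (d a b c : Fin m) :
    (localGeometry N D φ ψ).curv (tI d) (tI a) (tI b) (tI c) z = h.chiCurv φ z.1 d a b c := by
  rw [hD.curv_tI hz, hD.along_christoffel hz, hD.along_christoffel hz]
  simp only [hD.temporal φ ψ z hz]
  rfl

/-- The temporal coefficients along $x$ and $p$ vanish, and those along $t$ depend on $t$ only,
while the frame vector `Sum.inr C` has no $t$-component. -/
lemma curv_tI_inr (hD : IsHNormal h N D) (hz : z ∈ jetDomain φ ψ) (d a : Fin m) (B : DIdx m n)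
    (C : Fin n ⊕ Fin m × Fin n) :
    (localGeometry N D φ ψ).curv (tI d) (tI a) B (Sum.inr C) z = 0 := by
  rw [hD.curv_tI hz]
  rcases B with b | j | ⟨b, j⟩ <;> rcases C with k | ⟨c, k⟩ <;>
    simp [hD.spatial φ ψ z hz, hD.vertical φ ψ z hz, hD.along_Γ_tI_xI hz, hD.along_Γ_tI_pI hz,
      hD.along_christoffel hz, LocalGeometry.frame]

end IsHNormal
end Charts

/-! ### The deflection tensors and their six identities -/

theorem mainTheorem5 {m n : ℕ} {T M : Type*}
    [TopologicalSpace T] [ChartedSpace (Coord m) T] [IsManifold (𝓡 m) ∞ T]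
    [TopologicalSpace M] [ChartedSpace (Coord n) M] [IsManifold (𝓡 n) ∞ M]
    (h : SemiRiemannianMetric m T) (N : NonlinearConnection m n T M)
    (D : LinearConnection m n T M) (hD : IsCartanType h N D)
    (φ : SmoothChart m T) (ψ : SmoothChart n M) (z : JCoord m n) (hz : z ∈ jetDomain φ ψ) :
    let G := localGeometry N D φ ψ
    let p : Fin m → Fin n → ℝ := z.2.2
    let χ := h.christoffel φ z.1
    let χR := h.chiCurv φ z.1
    -- the expressions of the deflection d-tensors
    (∀ a i b, G.defl (pI a i) (tI b) z
      = -N.N1 φ ψ a i b z - ∑ r, G.Γ (xI r) (xI i) (tI b) z * p a r + ∑ f, χ a f b * p f i) ∧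
    (∀ a i j, G.defl (pI a i) (xI j) z
      = -N.N2 φ ψ a i j z - ∑ r, G.Γ (xI r) (xI i) (xI j) z * p a r) ∧
    (∀ a i b j, G.defl (pI a i) (pI b j) z
      = (if a = b then 1 else 0) * (if i = j then 1 else 0)
        - ∑ r, G.Γ (xI r) (xI i) (pI b j) z * p a r) ∧
    -- the six deflection d-tensor identities
    (∀ a i b c,
      G.covDefl (pI a i) (tI b) (tI c) z - G.covDefl (pI a i) (tI c) (tI b) z
        = -(∑ r, p a r * G.curv (xI r) (xI i) (tI b) (tI c) z) + ∑ f, p f i * χR a f b c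
          - ∑ f, ∑ r, G.defl (pI a i) (pI f r) z * G.tors (pI f r) (tI b) (tI c) z) ∧
    (∀ a i b k,
      G.covDefl (pI a i) (tI b) (xI k) z - G.covDefl (pI a i) (xI k) (tI b) z
        = -(∑ r, p a r * G.curv (xI r) (xI i) (tI b) (xI k) z)
          - ∑ r, G.defl (pI a i) (xI r) z * G.tors (xI r) (tI b) (xI k) z
          - ∑ f, ∑ r, G.defl (pI a i) (pI f r) z * G.tors (pI f r) (tI b) (xI k) z) ∧
    (∀ a i j k,
      G.covDefl (pI a i) (xI j) (xI k) z - G.covDefl (pI a i) (xI k) (xI j) z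
        = -(∑ r, p a r * G.curv (xI r) (xI i) (xI j) (xI k) z)
          - ∑ f, ∑ r, G.defl (pI a i) (pI f r) z * G.tors (pI f r) (xI j) (xI k) z) ∧
    (∀ a i b c k,
      G.covDefl (pI a i) (tI b) (pI c k) z - G.covDefl (pI a i) (pI c k) (tI b) z
        = -(∑ r, p a r * G.curv (xI r) (xI i) (tI b) (pI c k) z)
          - ∑ f, ∑ r, G.defl (pI a i) (pI f r) z * G.tors (pI f r) (tI b) (pI c k) z) ∧
    (∀ a i j c k,
      G.covDefl (pI a i) (xI j) (pI c k) z - G.covDefl (pI a i) (pI c k) (xI j) z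
        = -(∑ r, p a r * G.curv (xI r) (xI i) (xI j) (pI c k) z)
          - ∑ r, G.defl (pI a i) (xI r) z * G.Γ (xI r) (xI j) (pI c k) z
          - ∑ f, ∑ r, G.defl (pI a i) (pI f r) z * G.tors (pI f r) (xI j) (pI c k) z) ∧
    (∀ a i b j c k,
      G.covDefl (pI a i) (pI b j) (pI c k) z - G.covDefl (pI a i) (pI c k) (pI b j) z
        = -(∑ r, p a r * G.curv (xI r) (xI i) (pI b j) (pI c k) z)
          - ∑ f, ∑ r, G.defl (pI a i) (pI f r) z * G.tors (pI f r) (pI b j) (pI c k) z) := by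
  intro G p χ χR
  have hG : G.IsSmoothOn (jetDomain φ ψ) := localGeometry_isSmoothOn N D φ ψ
  have hN : G.IsNLinearOn (jetDomain φ ψ) := hD.nLinear φ ψ
  have hV : G.IsVerticallyInducedOn (jetDomain φ ψ) := hD.isVerticallyInducedOn φ ψ
  have hT (a b c) : G.Γ (tI a) (tI b) (tI c) z = h.christoffel φ z.1 a b c :=
    hD.temporal φ ψ z hz a b c
  have hS (a b i) : G.Γ (tI a) (tI b) (xI i) z = 0 := hD.spatial φ ψ z hz a b i
  have hC (a b c i) : G.Γ (tI a) (tI b) (pI c i) z = 0 := hD.vertical φ ψ z hz a b c i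
  have hχ (a b c) : h.christoffel φ z.1 a b c = h.christoffel φ z.1 a c b :=
    h.christoffel_comm φ hz.1 a b c
  have hΓH (i j k) : G.Γ (xI i) (xI j) (xI k) z = G.Γ (xI i) (xI k) (xI j) z :=
    hD.symmH φ ψ z hz i j k
  have hcurvT (a f b c) : G.curv (tI a) (tI f) (tI b) (tI c) z = h.chiCurv φ z.1 a f b c :=
    hD.curv_tI_tI_tI hz a f b c
  have hcurv0 (a f B C) : G.curv (tI a) (tI f) B (Sum.inr C) z = 0 := hD.curv_tI_inr hz a f B C
  have hinr (F b C) : G.Γ (Sum.inr F) (tI b) C z = 0 := LocalGeometry.Γ_inr_tI hG hN hz F b C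
  have htx (a j C) : G.Γ (tI a) (xI j) C z = 0 := LocalGeometry.Γ_tI_xI hG hN hz a j C
  have htp (a b j C) : G.Γ (tI a) (pI b j) C z = 0 := LocalGeometry.Γ_tI_pI hG hN hz a b j C
  have hxp (i b j C) : G.Γ (xI i) (pI b j) C z = 0 := LocalGeometry.Γ_xI_pI hG hN hz i b j C
  have hdefl (a i C) := LocalGeometry.defl_pI hV hz a i C
  have hricci (a i B C) := LocalGeometry.covDefl_sub_covDefl hG hN hV hz a i B C
  refine ⟨fun a i b => ?_, fun a i j => ?_, fun a i b j => ?_, fun a i b c => ?_,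
    fun a i b k => ?_, fun a i j k => ?_, fun a i b c k => ?_, fun a i j c k => ?_,
    fun a i b j c k => ?_⟩
  · have hfr : (G.frame (tI b) z).2.2 a i = -N.N1 φ ψ a i b z := rfl
    simp only [hdefl, hfr, hT, p, χ, mul_comm]
    ring
  · have hfr : (G.frame (xI j) z).2.2 a i = -N.N2 φ ψ a i j z := rfl
    simp [hdefl, hfr, hS, p, mul_comm]
  · have hfr : (G.frame (pI b j) z).2.2 a i
        = (if a = b then 1 else 0) * (if i = j then 1 else 0) := by
      simp only [LocalGeometry.frame, Pi.single_apply, ite_apply]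
      split_ifs <;> simp
    simp [hdefl, hfr, hC, p, mul_comm]
  · rw [hricci]
    -- Symmetry of $\chi$ removes the temporal torsion; $N$-linearity removes the spatial one.
    simp [hT, hinr, hcurvT, hχ _ c b, p, χR]
  · rw [hricci]
    -- The spatial antisymmetrized coefficient is exactly $T^r_{bk}$, by `tors_xI`.
    simp [hS, htx, hinr, LocalGeometry.tors_xI hG hz, hcurv0, p]
  · rw [hricci]
    -- Here $H^i_{jk}=H^i_{kj}$ removes the spatial torsion.
    simp [htx, hΓH _ k j, hcurv0, p]
  · rw [hricci]
    simp [hC, htp, hinr, hxp, hcurv0, p]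
  · rw [hricci]
    -- Of the two spatial coefficients only $C^{r(k)}_{j(c)}$ survives; the other is a spatial
    -- component of the derivative of a vertical vector.
    simp [htx, htp, hxp, hcurv0, p]
  · rw [hricci]
    simp [htp, hxp, hcurv0, p]
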